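/- All graphs are finite and simple. The competition graph of a digraph $D$ is the graph with the same vertex set as $D$ in which two distinct vertices $x,y$ are adjacent if and only if there is a vertex $v$ such that $(x,v)$ and $(y,v)$ are arcs of $D$. The competition number $k(G)$ of a graph $G$ is the smallest $k\ge 0$ such that $G$ together with $k$ additional isolated vertices is the competition graph of an acyclic digraph. A hole of $G$ is an induced subgraph of $G$ that is a cycle of length at least $4$; $h(G)$ denotes the number of holes of $G$. For a hole $C$ let $\chi_C\in\mathbb{F}_2^{E(G)}$ be the characteristic vector of its edge set, and let the hole space $\mathcal{H}(G)\subseteq\mathbb{F}_2^{E(G)}$ be the $\mathbb{F}_2$-span of the vectors $\chi_C$ over all holes $C$ of $G$. Proposition. Let $G$ be a graph such that any two distinct holes of $G$ are edge-disjoint. Then the vectors $\chi_C$, with $C$ ranging over the holes of $G$, are linearly independent over $\mathbb{F}_2$, so that $\dim\mathcal{H}(G)=h(G)$, and $$k(G)\le\dim\mathcal{H}(G)+1.$$ -/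

import Mathlib

/-- A digraph is acyclic if it has no directed closed walk of positive length
(equivalently, no directed cycle; in particular no loops). -/
def Digraph.IsAcyclic {V : Type*} (D : Digraph V) : Prop :=
  ∀ v : V, ¬ Relation.TransGen D.Adj v v

/-- The competition graph of a digraph: two distinct vertices are adjacent iff they have a
common out-neighbour. -/
def Digraph.competitionGraph {V : Type*} (D : Digraph V) : SimpleGraph V where
  Adj x y := x ≠ y ∧ ∃ v : V, D.Adj x v ∧ D.Adj y v
  symm := ⟨fun _ _ h => ⟨h.1.symm, h.2.imp fun _ hv => ⟨hv.2, hv.1⟩⟩⟩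
  loopless := ⟨fun _ h => h.1 rfl⟩

namespace SimpleGraph

/-- `G` together with `k` additional isolated vertices. -/
abbrev addIsolated {V : Type*} (G : SimpleGraph V) (k : ℕ) : SimpleGraph (V ⊕ Fin k) :=
  G ⊕g (⊥ : SimpleGraph (Fin k))

/-- `G` together with `k` isolated vertices is the competition graph of an acyclic digraph. -/
def IsCompetitionGraphAfterAdding {V : Type*} (G : SimpleGraph V) (k : ℕ) : Prop :=
  ∃ D : Digraph (V ⊕ Fin k), D.IsAcyclic ∧ D.competitionGraph = G.addIsolated k

/-- The competition number: the smallest `k` such that `G` together with `k` isolated vertices is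
the competition graph of an acyclic digraph. For finite graphs such a `k` exists, see
`exists_isCompetitionGraphAfterAdding`. -/
noncomputable def competitionNumber {V : Type*} (G : SimpleGraph V) : ℕ :=
  sInf {k : ℕ | G.IsCompetitionGraphAfterAdding k}

theorem exists_isCompetitionGraphAfterAdding {V : Type*} [Finite V] (G : SimpleGraph V) :
    ∃ k : ℕ, G.IsCompetitionGraphAfterAdding k := by
  obtain ⟨k, ⟨f⟩⟩ := Finite.exists_equiv_fin G.edgeSet
  let A : V ⊕ Fin k → V ⊕ Fin k → Prop := fun a b =>
    ∃ (x : V) (i : Fin k), a = Sum.inl x ∧ b = Sum.inr i ∧ x ∈ (f.symm i : Sym2 V)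
  have key : ∀ a b, Relation.TransGen A a b → a.isLeft ∧ b.isRight := by
    intro a b h
    induction h with
    | single h => obtain ⟨x, i, rfl, rfl, -⟩ := h; simp
    | tail _ h ih => obtain ⟨x, i, rfl, rfl, -⟩ := h; simp at ih
  refine ⟨k, ⟨A⟩, fun v h => ?_, ?_⟩
  · have := key v v h
    cases v <;> simp at this
  · ext a b
    constructor
    · rintro ⟨hne, v, ⟨x, i, rfl, rfl, hx⟩, ⟨y, j, rfl, hj, hy⟩⟩
      obtain rfl := Sum.inr_injective hj
      have hxy : x ≠ y := fun h => hne (congrArg Sum.inl h)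
      have he : (f.symm i : Sym2 V) = s(x, y) := (Sym2.mem_and_mem_iff hxy).1 ⟨hx, hy⟩
      have := (f.symm i).2
      rw [he] at this
      simpa using this
    · intro h
      rcases a with x | i <;> rcases b with y | j
      · have hxy : G.Adj x y := by simpa using h
        refine ⟨fun h => hxy.ne (Sum.inl_injective h), Sum.inr (f ⟨s(x, y), hxy⟩), ?_, ?_⟩
        · exact ⟨x, _, rfl, rfl, by simp⟩
        · exact ⟨y, _, rfl, rfl, by simp⟩
      all_goals simp at h

/-- A hole: an induced subgraph that is a cycle of length at least `4`. -/
def Subgraph.IsHole {V : Type*} {G : SimpleGraph V} (C : G.Subgraph) : Prop :=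
  C.IsInduced ∧ ∃ n : ℕ, 4 ≤ n ∧ Nonempty (C.coe ≃g cycleGraph n)

/-- The number of holes. -/
noncomputable def holeNumber {V : Type*} (G : SimpleGraph V) : ℕ :=
  {C : G.Subgraph | C.IsHole}.ncard

open Classical in
/-- The characteristic vector in `𝔽₂^{E(G)}` of the edge set of a subgraph. -/
noncomputable def Subgraph.edgeVector {V : Type*} {G : SimpleGraph V} (C : G.Subgraph) :
    G.edgeSet → ZMod 2 :=
  fun e => if (e : Sym2 V) ∈ C.edgeSet then 1 else 0

/-- The hole space: the span over `𝔽₂` of the characteristic vectors of the holes. -/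
def holeSpace {V : Type*} (G : SimpleGraph V) : Submodule (ZMod 2) (G.edgeSet → ZMod 2) :=
  Submodule.span (ZMod 2) {χ | ∃ C : G.Subgraph, C.IsHole ∧ C.edgeVector = χ}

end SimpleGraph

/-!
The competition number is bounded by eliminating vertices one at a time. Suppose `v` is eliminated
from the subgraph induced on `W`, and its remaining neighbours are a union of `θ` cliques. Each of
these cliques together with `v` gets a common out-neighbour among the available sinks, which covers
all edges at `v` and uses up `θ` sinks; afterwards `v` itself can serve as a sink for the vertices
still to be eliminated (`SimpleGraph.IsRealizedOn.of_diff_singleton`). So eliminating `v` costs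
`θ - 1` sinks, and it suffices to find `v` for which this is at most the number of holes through
`v`.

Such a `v` is an avoidable vertex: one for which any two non-adjacent neighbours `x`, `y` are
joined by a path outside the closed neighbourhood of `v`. Every nonempty graph has an avoidable
vertex (`SimpleGraph.exists_isAvoidable`), and a shortest path from `x` to `y` closes up to a hole
through `x`, `v`, `y` (`SimpleGraph.exists_isHole_of_isAvoidable`). When holes are pairwise
edge-disjoint, the edge `vx` lies on at most one hole, so each neighbour `x` of `v` has at most one
non-neighbour among the neighbours of `v`. Hence non-adjacency is a matching on the neighbours, and
these are a union of two cliques (`SimpleGraph.exists_isClique_union_eq`). Either the neighbours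
form one clique and `v` costs nothing, or `v` costs one sink and lies on a hole.

The edge vectors are independent because they have nonempty, pairwise disjoint supports.
-/

namespace SimpleGraph

variable {V : Type*} {G : SimpleGraph V}

/-! ### Avoidable vertices -/

/-- The vertex `v` is avoidable in the subgraph induced on `W`: any two distinct non-adjacent
neighbours `x`, `y` of `v` in `W` are both adjacent to some connected set `C ⊆ W` that contains
neither `v` nor a neighbour of `v`. A vertex with no two non-adjacent neighbours in `W`, that is,
a simplicial one, is avoidable vacuously. -/
def IsAvoidable (G : SimpleGraph V) (W : Set V) (v : V) : Prop :=
  ∀ x ∈ W, ∀ y ∈ W, G.Adj v x → G.Adj v y → x ≠ y → ¬ G.Adj x y →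
    ∃ C ⊆ W, (G.induce C).Preconnected ∧ (∀ c ∈ C, c ≠ v ∧ ¬ G.Adj v c) ∧
      (∃ c ∈ C, G.Adj x c) ∧ ∃ c ∈ C, G.Adj y c

/-- Every nonempty set of vertices `W` contains a vertex that is avoidable in `W`. Take a maximal
connected `C ⊆ W` whose closed neighbourhood misses some vertex of `W`. The set `R` of missed
vertices is completely joined to the remaining vertices, which are all neighbours of `C`, so a
vertex that is avoidable in `R` is avoidable in `W`. -/
theorem exists_isAvoidable [Finite V] (G : SimpleGraph V) (W : Set V) (hW : W.Nonempty) :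
    ∃ v ∈ W, G.IsAvoidable W v := by
  induction h : W.ncard using Nat.strong_induction_on generalizing W with
  | _ n ih =>
  subst h
  let far : Set V → Set V := fun C => {r | r ∈ W ∧ r ∉ C ∧ ∀ c ∈ C, ¬ G.Adj r c}
  let 𝒞 : Set (Set V) :=
    {C | C ⊆ W ∧ C.Nonempty ∧ (G.induce C).Preconnected ∧ (far C).Nonempty}
  by_cases h𝒞 : 𝒞.Nonempty
  · obtain ⟨C, hC⟩ := 𝒞.toFinite.exists_maximal h𝒞
    obtain ⟨⟨hCW, ⟨c₀, hc₀⟩, hconn, hne⟩, hmax⟩ := hC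
    -- by maximality, a neighbour `s` of `C` is adjacent to all of `far C`
    have hjoin : ∀ s ∈ W, s ∉ C → (∃ c ∈ C, G.Adj s c) → ∀ r ∈ far C, G.Adj r s := by
      rintro s hs hsC ⟨c, hc, hsc⟩ r ⟨hrW, hrC, hr⟩
      by_contra hrs
      have hmem : insert s C ∈ 𝒞 := by
        refine ⟨Set.insert_subset hs hCW, ⟨s, by simp⟩, ?_, r, hrW, ?_, ?_⟩
        · have := connected_induce_union (s := {s}) (t := C) (v := s) (w := c)
            (.of_subsingleton) hconn rfl hc hsc
          exact this.preconnected
        · rintro (rfl | h)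
          · exact hr c hc hsc
          · exact hrC h
        · rintro d (rfl | hd)
          · exact hrs
          · exact hr d hd
      exact hsC (hmax hmem (Set.subset_insert s C) (Set.mem_insert s C))
    have hlt : (far C).ncard < W.ncard :=
      Set.ncard_lt_ncard ⟨fun r hr => hr.1, fun h => (h (hCW hc₀)).2.1 hc₀⟩
    obtain ⟨v, hv, hav⟩ := ih _ hlt (far C) hne rfl
    refine ⟨v, hv.1, fun x hx y hy hvx hvy hxy hnadj => ?_⟩
    have hout : ∀ z, G.Adj v z → z ∉ C := fun z hvz hz => hv.2.2 z hz hvz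
    have hcase : ∀ z ∈ W, G.Adj v z → z ∉ far C → ∃ c ∈ C, G.Adj z c := by
      intro z hz hvz hzf
      by_contra! hcon
      exact hzf ⟨hz, hout z hvz, hcon⟩
    by_cases hxf : x ∈ far C
    · by_cases hyf : y ∈ far C
      · obtain ⟨K, hK, h⟩ := hav x hxf y hyf hvx hvy hxy hnadj
        exact ⟨K, fun k hk => (hK hk).1, h⟩
      · exact absurd (hjoin y hy (hout y hvy) (hcase y hy hvy hyf) x hxf) hnadj
    · by_cases hyf : y ∈ far C
      · exact absurd (hjoin x hx (hout x hvx) (hcase x hx hvx hxf) y hyf).symm hnadj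
      · exact ⟨C, hCW, hconn, fun c hc => ⟨fun h => hv.2.1 (h ▸ hc), hv.2.2 c hc⟩,
          hcase x hx hvx hxf, hcase y hy hvy hyf⟩
  · -- if no such `C` exists, then singletons show that `W` is a clique
    obtain ⟨v, hv⟩ := hW
    refine ⟨v, hv, fun x hx y hy _ _ hxy hnadj => absurd ⟨{x}, ?_⟩ h𝒞⟩
    refine ⟨by simpa using hx, by simp, .of_subsingleton, y, hy, ?_, ?_⟩
    · simpa using hxy.symm
    · simpa [G.adj_comm y x] using hnadj

/-! ### Holes through an avoidable vertex -/

theorem cycleGraph_adj_iff_of_lt {n : ℕ} {i j : Fin n} (hij : i < j) :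
    (cycleGraph n).Adj i j ↔ (j : ℕ) = i + 1 ∨ ((i : ℕ) = 0 ∧ (j : ℕ) + 1 = n) := by
  have hi := i.2
  have hj := j.2
  have hij' : (i : ℕ) < j := hij
  have h₁ : (i - j).val = n - j + i := by
    rw [Fin.sub_def]
    exact Nat.mod_eq_of_lt (by omega)
  have h₂ : (j - i).val = j - i := Fin.coe_sub_iff_le.2 hij.le
  rw [cycleGraph_adj', h₁, h₂]
  omega

/-- A walk that realizes the distance between its ends is an induced path. -/
theorem Walk.adj_getVert_iff_of_length_eq_dist {x y : V} {p : G.Walk x y}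
    (hp : p.length = G.dist x y) {i j : ℕ} (hij : i < j) (hj : j ≤ p.length) :
    G.Adj (p.getVert i) (p.getVert j) ↔ j = i + 1 := by
  constructor
  · intro h
    have := dist_le ((p.take i).append (.cons h (p.drop j)))
    simp only [Walk.length_append, Walk.take_length, Walk.length_cons, Walk.drop_length] at this
    omega
  · rintro rfl
    exact p.adj_getVert_succ hj

/-- An injection of `Fin n`, `4 ≤ n`, onto an induced cycle gives a hole. -/
theorem Subgraph.isHole_induce_range {n : ℕ} (hn : 4 ≤ n) (f : Fin n → V)
    (hf : Function.Injective f)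
    (hadj : ∀ i j, i < j → (G.Adj (f i) (f j) ↔ (cycleGraph n).Adj i j)) :
    ((⊤ : G.Subgraph).induce (Set.range f)).IsHole := by
  have hadj' : ∀ i j, G.Adj (f i) (f j) ↔ (cycleGraph n).Adj i j := by
    intro i j
    rcases lt_trichotomy i j with h | rfl | h
    · exact hadj i j h
    · simp
    · rw [G.adj_comm, hadj j i h, SimpleGraph.adj_comm]
  refine ⟨(Subgraph.isInduced_iff_exists_eq_induce_top _).2 ⟨_, rfl⟩, n, hn, ⟨?_⟩⟩
  refine RelIso.symm ⟨Equiv.ofInjective f hf, ?_⟩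
  intro i j
  rw [← hadj' i j]
  exact ⟨fun h => h.2.2, fun h => ⟨⟨i, rfl⟩, ⟨j, rfl⟩, h⟩⟩

/-- Two non-adjacent neighbours `x`, `y` of `v` that are joined through a connected set avoiding
the closed neighbourhood of `v` are the two neighbours of `v` on some hole: close a shortest path
from `x` to `y` by `v`. -/
theorem exists_isHole_of_isAvoidable {W : Set V} {v : V} (hv : v ∈ W) (hav : G.IsAvoidable W v)
    {x y : V} (hx : x ∈ W) (hy : y ∈ W) (hvx : G.Adj v x) (hvy : G.Adj v y) (hxy : x ≠ y)
    (hnadj : ¬ G.Adj x y) :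
    ∃ C : G.Subgraph, C.IsHole ∧ C.verts ⊆ W ∧ ∀ z, C.Adj v z ↔ z = x ∨ z = y := by
  obtain ⟨K, hKW, hK, hKv, ⟨a, haK, hxa⟩, ⟨b, hbK, hyb⟩⟩ := hav x hx y hy hvx hvy hxy hnadj
  let Z : Set V := ({x} ∪ K) ∪ {y}
  have hZ : (G.induce Z).Connected := by
    have h₁ := connected_induce_union (s := {x}) (t := K) (.of_subsingleton) hK rfl haK hxa
    exact connected_induce_union (t := {y}) h₁.preconnected (.of_subsingleton)
      (Or.inr hbK) rfl hyb.symm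
  have hZW : Z ⊆ W := by
    rintro z ((rfl | h) | rfl)
    exacts [hx, hKW h, hy]
  have hvZ : v ∉ Z := by
    rintro ((h | h) | h)
    exacts [hvx.ne h, (hKv v h).1 rfl, hvy.ne h]
  have hZadj : ∀ z ∈ Z, G.Adj v z ↔ z = x ∨ z = y := by
    rintro z ((rfl | h) | rfl)
    · simpa using hvx
    · refine ⟨fun hvz => absurd hvz (hKv z h).2, ?_⟩
      rintro (rfl | rfl) <;> assumption
    · simpa using hvy
  let x' : Z := ⟨x, Or.inl (Or.inl rfl)⟩
  let y' : Z := ⟨y, Or.inr rfl⟩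
  obtain ⟨p, hpath, hp⟩ := hZ.exists_path_of_dist x' y'
  let q : ℕ → V := fun i => p.getVert i
  have hq0 : q 0 = x := by simp [q, x']
  have hqL : q p.length = y := by simp [q, y']
  have hqZ : ∀ i, q i ∈ Z := fun i => (p.getVert i).2
  have hqinj : ∀ i j, i ≤ p.length → j ≤ p.length → q i = q j → i = j :=
    fun i j hi hj h => hpath.getVert_injOn hi hj (Subtype.ext h)
  have hqadj : ∀ i j, i < j → j ≤ p.length → (G.Adj (q i) (q j) ↔ j = i + 1) :=
    fun i j hij hj => Walk.adj_getVert_iff_of_length_eq_dist hp hij hj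
  have hL : 2 ≤ p.length := by
    by_contra! hlt
    interval_cases h : p.length
    · exact hxy (hq0.symm.trans hqL)
    · exact hnadj (by simpa [hq0, hqL] using hqadj 0 1 one_pos le_rfl)
  have hvq : ∀ i ≤ p.length, G.Adj v (q i) ↔ i = 0 ∨ i = p.length := by
    intro i hi
    rw [hZadj _ (hqZ i)]
    constructor
    · rintro (h | h)
      · exact Or.inl (hqinj i 0 hi (Nat.zero_le _) (h.trans hq0.symm))
      · exact Or.inr (hqinj i _ hi le_rfl (h.trans hqL.symm))
    · rintro (rfl | rfl)
      exacts [Or.inl hq0, Or.inr hqL]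
  -- the cycle is `v, q 0, q 1, …, q p.length`
  let f : Fin (p.length + 2) → V := Fin.cons v fun i => q i
  have hf0 : f 0 = v := rfl
  have hfs : ∀ i : Fin (p.length + 1), f i.succ = q i := fun i => rfl
  have hrange : Set.range f ⊆ W := by
    rintro _ ⟨i, rfl⟩
    induction i using Fin.cases with
    | zero => exact hv
    | succ i => exact hZW (hqZ i)
  have hf : Function.Injective f := by
    refine Fin.cons_injective_iff.2 ⟨?_, ?_⟩
    · rintro ⟨i, hi⟩
      exact hvZ (hi ▸ hqZ i)
    · intro i j hij
      exact Fin.ext (hqinj i j (Nat.lt_succ_iff.1 i.2) (Nat.lt_succ_iff.1 j.2) hij)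
  refine ⟨(⊤ : G.Subgraph).induce (Set.range f),
    Subgraph.isHole_induce_range (by omega) f hf ?_, hrange, ?_⟩
  · intro i j hij
    rw [cycleGraph_adj_iff_of_lt hij]
    induction j using Fin.cases with
    | zero => exact absurd hij (Fin.not_lt_zero i)
    | succ j =>
      have hj := Nat.lt_succ_iff.1 j.2
      induction i using Fin.cases with
      | zero =>
        rw [hf0, hfs, hvq j hj]
        simp
      | succ i =>
        rw [hfs, hfs, hqadj i j (by simpa using hij) hj]
        simp
  · intro z
    simp only [Subgraph.induce_adj, Subgraph.top_adj]
    constructor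
    · rintro ⟨-, ⟨i, rfl⟩, h⟩
      induction i using Fin.cases with
      | zero => exact absurd h (G.irrefl)
      | succ i => exact (hZadj _ (hqZ i)).1 h
    · rintro (rfl | rfl)
      · exact ⟨⟨0, rfl⟩, ⟨Fin.succ 0, hq0⟩, hvx⟩
      · exact ⟨⟨0, rfl⟩, ⟨Fin.succ (Fin.last _), hqL⟩, hvy⟩

/-! ### Cliques around an avoidable vertex -/

/-- The number of holes with all vertices in `W`. -/
noncomputable def holeNumberOn (G : SimpleGraph V) (W : Set V) : ℕ :=
  {C : G.Subgraph | C.IsHole ∧ C.verts ⊆ W}.ncard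

theorem holeNumberOn_univ (G : SimpleGraph V) : G.holeNumberOn Set.univ = G.holeNumber := by
  simp [holeNumberOn, holeNumber]

theorem holeNumberOn_mono [Finite V] {W W' : Set V} (h : W ⊆ W') :
    G.holeNumberOn W ≤ G.holeNumberOn W' :=
  Set.ncard_le_ncard fun _ hC => ⟨hC.1, hC.2.trans h⟩

theorem holeNumberOn_diff_singleton_lt [Finite V] {W : Set V} {C : G.Subgraph} (hC : C.IsHole)
    (hCW : C.verts ⊆ W) {v : V} (hv : v ∈ C.verts) :
    G.holeNumberOn (W \ {v}) < G.holeNumberOn W :=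
  Set.ncard_lt_ncard ⟨fun _ h => ⟨h.1, h.2.trans Set.sdiff_subset⟩,
    fun h => (@h C ⟨hC, hCW⟩).2 hv |>.2 rfl⟩

/-- If no vertex of `N` has two distinct non-neighbours in `N`, then `N` is a union of two
cliques: non-adjacency is a matching, and the cliques take one end of each matching edge each. -/
theorem exists_isClique_union_eq [Finite V] {N : Set V}
    (h : ∀ x ∈ N, ∀ y ∈ N, ∀ z ∈ N, x ≠ y → x ≠ z → ¬ G.Adj x y → ¬ G.Adj x z → y = z) :
    ∃ Q₁ Q₂ : Set V, G.IsClique Q₁ ∧ G.IsClique Q₂ ∧ Q₁ ∪ Q₂ = N := by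
  -- an injective numbering of the vertices decides which end goes where
  obtain ⟨n, ⟨e⟩⟩ := Finite.exists_equiv_fin V
  refine ⟨{x ∈ N | ∀ y ∈ N, x ≠ y → ¬ G.Adj x y → e x < e y},
    {x ∈ N | ∀ y ∈ N, x ≠ y → ¬ G.Adj x y → e y < e x}, ?_, ?_, ?_⟩
  · intro x hx y hy hxy
    by_contra hadj
    exact lt_asymm (hx.2 y hy.1 hxy hadj) (hy.2 x hx.1 hxy.symm fun h => hadj h.symm)
  · intro x hx y hy hxy
    by_contra hadj
    exact lt_asymm (hx.2 y hy.1 hxy hadj) (hy.2 x hx.1 hxy.symm fun h => hadj h.symm)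
  · refine Set.Subset.antisymm (Set.union_subset (fun _ hx => hx.1) fun _ hx => hx.1) ?_
    intro x hx
    by_cases hex : ∃ y ∈ N, x ≠ y ∧ ¬ G.Adj x y
    · obtain ⟨y, hy, hxy, hadj⟩ := hex
      rcases lt_or_gt_of_ne (e.injective.ne hxy) with hlt | hlt
      · exact Or.inl ⟨hx, fun z hz hxz hadj' => h x hx y hy z hz hxy hxz hadj hadj' ▸ hlt⟩
      · exact Or.inr ⟨hx, fun z hz hxz hadj' => h x hx y hy z hz hxy hxz hadj hadj' ▸ hlt⟩
    · exact Or.inl ⟨hx, fun y hy hxy hadj => absurd ⟨y, hy, hxy, hadj⟩ hex⟩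

/-- When holes are pairwise edge-disjoint, no neighbour `x` of an avoidable vertex `v` has two
non-neighbours among the neighbours of `v`, since these would give two holes through `vx`. -/
theorem IsAvoidable.eq_of_not_adj {W : Set V} {v : V} (hv : v ∈ W) (hav : G.IsAvoidable W v)
    (hG : ∀ C C' : G.Subgraph, C.IsHole → C'.IsHole → C ≠ C' → Disjoint C.edgeSet C'.edgeSet)
    {x y z : V} (hx : x ∈ W ∩ G.neighborSet v) (hy : y ∈ W ∩ G.neighborSet v)
    (hz : z ∈ W ∩ G.neighborSet v) (hxy : x ≠ y) (hxz : x ≠ z) (hnxy : ¬ G.Adj x y)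
    (hnxz : ¬ G.Adj x z) : y = z := by
  obtain ⟨C, hC, -, hCv⟩ := exists_isHole_of_isAvoidable hv hav hx.1 hy.1 hx.2 hy.2 hxy hnxy
  obtain ⟨C', hC', -, hCv'⟩ := exists_isHole_of_isAvoidable hv hav hx.1 hz.1 hx.2 hz.2 hxz hnxz
  obtain rfl : C = C' := by
    by_contra hne
    have hmem : s(v, x) ∈ C.edgeSet := Subgraph.mem_edgeSet.2 ((hCv x).2 (Or.inl rfl))
    have hmem' : s(v, x) ∈ C'.edgeSet := Subgraph.mem_edgeSet.2 ((hCv' x).2 (Or.inl rfl))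
    exact Set.disjoint_left.1 (hG C C' hC hC' hne) hmem hmem'
  exact ((hCv' y).1 ((hCv y).2 (Or.inr rfl))).resolve_left hxy.symm

/-! ### Building the digraph -/

/-- The arcs of an acyclic digraph realizing the subgraph of `G` induced on `W` as a competition
graph: arcs start in `W` and end in `W` or in the set `T` of sinks. Acyclicity is witnessed by a
rank function that decreases along arcs. -/
def IsRealizedOn {U : Type*} (G : SimpleGraph V) (φ : V → U) (W : Set V) (T : Set U) : Prop :=
  ∃ (A : U → U → Prop) (r : U → ℕ),
    (∀ a b, A a b → a ∈ φ '' W ∧ b ∈ φ '' W ∪ T ∧ r b < r a) ∧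
      ∀ x ∈ W, ∀ y ∈ W, x ≠ y → (G.Adj x y ↔ ∃ u, A (φ x) u ∧ A (φ y) u)

/-- A realization of `W \ {v}` that uses `v` as a sink extends to `W` at the expense of new sinks
`t ∈ S`, each being the common out-neighbour of `v` and a clique `Q t` of neighbours of `v`. -/
theorem IsRealizedOn.of_diff_singleton {U : Type*} {φ : V → U} (hφ : Function.Injective φ)
    {W : Set V} {v : V} (hv : v ∈ W) {S T : Set U} (hT : Disjoint (φ '' W) T) (hST : S ⊆ T)
    (Q : U → Set V) (hQ : ∀ t ∈ S, G.IsClique (Q t))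
    (hcover : ⋃ t ∈ S, Q t = W ∩ G.neighborSet v)
    (h : G.IsRealizedOn φ (W \ {v}) (insert (φ v) (T \ S))) : G.IsRealizedOn φ W T := by
  classical
  obtain ⟨A, r, hA, hAG⟩ := h
  have hQsub : ∀ t ∈ S, ∀ x ∈ Q t, x ∈ W ∧ G.Adj v x := fun t ht x hx =>
    hcover.subset (Set.mem_biUnion ht hx)
  have hWT : ∀ x ∈ W, φ x ∉ T := fun x hx => Set.disjoint_left.1 hT ⟨x, hx, rfl⟩
  have hAS : ∀ a t, t ∈ S → ¬ A a t := by
    intro a t ht hat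
    obtain ⟨-, (⟨x, hx, rfl⟩ | rfl | hb), -⟩ := hA a t hat
    · exact hWT x hx.1 (hST ht)
    · exact hWT v hv (hST ht)
    · exact hb.2 ht
  have hAv : ∀ b, ¬ A (φ v) b := by
    intro b hvb
    obtain ⟨x, hx, hxv⟩ := (hA _ _ hvb).1
    exact hx.2 (hφ hxv)
  -- shifting the rank by one makes room for the sinks in `T`, all at rank `0`
  refine ⟨fun a b => A a b ∨ b ∈ S ∧ ∃ x ∈ insert v (Q b), φ x = a,
    fun u => if u ∈ T then 0 else r u + 1, ?_, ?_⟩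
  · rintro a b (hab | ⟨hb, x, hx, rfl⟩)
    · obtain ⟨⟨x, hx, rfl⟩, hb, hr⟩ := hA a b hab
      refine ⟨⟨x, hx.1, rfl⟩, ?_, ?_⟩
      · rcases hb with ⟨y, hy, rfl⟩ | rfl | hb
        · exact Or.inl ⟨y, hy.1, rfl⟩
        · exact Or.inl ⟨v, hv, rfl⟩
        · exact Or.inr hb.1
      · simp only [hWT x hx.1, if_false]
        split_ifs <;> omega
    · have hxW : x ∈ W := by
        rcases hx with rfl | hx
        exacts [hv, (hQsub b hb x hx).1]
      exact ⟨⟨x, hxW, rfl⟩, Or.inr (hST hb), by simp [hWT x hxW, hST hb]⟩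
  · have hmem : ∀ t x, (∃ z ∈ insert v (Q t), φ z = φ x) ↔ x = v ∨ x ∈ Q t := by
      intro t x
      simp [hφ.eq_iff]
    simp only [hmem]
    have hvadj : ∀ y ∈ W, y ≠ v → (G.Adj v y ↔
        ∃ u, (A (φ v) u ∨ u ∈ S ∧ (v = v ∨ v ∈ Q u)) ∧
          (A (φ y) u ∨ u ∈ S ∧ (y = v ∨ y ∈ Q u))) := by
      intro y hy hyv
      constructor
      · intro hadj
        obtain ⟨t, ht, hyt⟩ := Set.mem_iUnion₂.1 (hcover.superset ⟨hy, hadj⟩)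
        exact ⟨t, Or.inr ⟨ht, Or.inl rfl⟩, Or.inr ⟨ht, Or.inr hyt⟩⟩
      · rintro ⟨u, h | ⟨hu, -⟩, h'⟩
        · exact absurd h (hAv u)
        · rcases h' with h' | ⟨-, h' | h'⟩
          · exact absurd h' (hAS _ u hu)
          · exact absurd h' hyv
          · exact (hQsub u hu y h').2
    intro x hx y hy hxy
    by_cases hxv : x = v
    · subst hxv
      exact hvadj y hy hxy.symm
    by_cases hyv : y = v
    · subst hyv
      rw [G.adj_comm, hvadj x hx hxy]
      exact exists_congr fun _ => and_comm
    rw [hAG x ⟨hx, hxv⟩ y ⟨hy, hyv⟩ hxy]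
    constructor
    · rintro ⟨u, h₁, h₂⟩
      exact ⟨u, Or.inl h₁, Or.inl h₂⟩
    · rintro ⟨u, h₁ | ⟨hu, h₁⟩, h₂ | ⟨hu', h₂⟩⟩
      · exact ⟨u, h₁, h₂⟩
      · exact absurd h₁ (hAS _ u hu')
      · exact absurd h₂ (hAS _ u hu)
      · exact (hAG x ⟨hx, hxv⟩ y ⟨hy, hyv⟩ hxy).1
          (hQ u hu (h₁.resolve_left hxv) (h₂.resolve_left hyv) hxy)

/-- Eliminating an avoidable vertex `v` uses up one sink if `v` is simplicial, and two if not; in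
the second case at least one hole is destroyed. In both cases `v` is a new sink for what remains,
so one sink more than the number of holes is enough. -/
theorem isRealizedOn_of_holeNumberOn_lt [Finite V] {U : Type*} [Finite U] {φ : V → U}
    (hφ : Function.Injective φ)
    (hG : ∀ C C' : G.Subgraph, C.IsHole → C'.IsHole → C ≠ C' → Disjoint C.edgeSet C'.edgeSet)
    (W : Set V) (T : Set U) (hT : Disjoint (φ '' W) T) (hcard : G.holeNumberOn W < T.ncard) :
    G.IsRealizedOn φ W T := by
  classical
  induction h : W.ncard using Nat.strong_induction_on generalizing W T with
  | _ n ih =>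
  subst h
  rcases W.eq_empty_or_nonempty with rfl | hW
  · exact ⟨fun _ _ => False, fun _ => 0, fun _ _ h => h.elim, fun x hx => hx.elim⟩
  obtain ⟨v, hv, hav⟩ := G.exists_isAvoidable W hW
  have hlt : (W \ {v}).ncard < W.ncard := Set.ncard_sdiff_singleton_lt_of_mem hv
  -- the induction hypothesis, applied after spending the sinks `S`
  have hstep : ∀ S ⊆ T, G.holeNumberOn (W \ {v}) + S.ncard ≤ T.ncard →
      G.IsRealizedOn φ (W \ {v}) (insert (φ v) (T \ S)) := by
    intro S hS hle
    have hvT : φ v ∉ T \ S := fun h => Set.disjoint_left.1 hT ⟨v, hv, rfl⟩ h.1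
    refine ih _ hlt _ _ ?_ ?_ rfl
    · rw [Set.disjoint_left]
      rintro _ ⟨x, hx, rfl⟩ (h | h)
      · exact hx.2 (hφ h)
      · exact Set.disjoint_left.1 hT ⟨x, hx.1, rfl⟩ h.1
    · rw [Set.ncard_insert_of_notMem hvT, Set.ncard_sdiff hS]
      omega
  have hmono : G.holeNumberOn (W \ {v}) ≤ G.holeNumberOn W := holeNumberOn_mono Set.sdiff_subset
  by_cases hclique : G.IsClique (W ∩ G.neighborSet v)
  · obtain ⟨t, ht⟩ : T.Nonempty := (Set.ncard_pos).1 (by omega)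
    refine .of_diff_singleton hφ hv hT (S := {t}) (by simpa using ht)
      (fun _ => W ∩ G.neighborSet v) (fun _ _ => hclique) (by simp) (hstep _ (by simpa using ht) ?_)
    rw [Set.ncard_singleton]
    omega
  · have hdrop : G.holeNumberOn (W \ {v}) < G.holeNumberOn W := by
      simp only [IsClique, Set.Pairwise, not_forall] at hclique
      obtain ⟨x, hx, y, hy, hxy, hnadj⟩ := hclique
      obtain ⟨C, hC, hCW, hCv⟩ :=
        exists_isHole_of_isAvoidable hv hav hx.1 hy.1 hx.2 hy.2 hxy hnadj
      exact holeNumberOn_diff_singleton_lt hC hCW ((hCv x).2 (Or.inl rfl)).fst_mem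
    obtain ⟨Q₁, Q₂, hQ₁, hQ₂, hQ⟩ := exists_isClique_union_eq (G := G)
      (N := W ∩ G.neighborSet v) fun x hx y hy z hz => hav.eq_of_not_adj hv hG hx hy hz
    obtain ⟨t₁, ht₁, t₂, ht₂, hne⟩ := (Set.one_lt_ncard).1 (show 1 < T.ncard by omega)
    have hST : {t₁, t₂} ⊆ T := Set.insert_subset ht₁ (by simpa using ht₂)
    refine .of_diff_singleton hφ hv hT hST (fun t => if t = t₁ then Q₁ else Q₂) ?_ ?_
      (hstep _ hST ?_)
    · intro t _
      split_ifs
      exacts [hQ₁, hQ₂]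
    · simp [hne.symm, hQ]
    · rw [Set.ncard_pair hne]
      omega

theorem IsRealizedOn.isCompetitionGraphAfterAdding {k : ℕ}
    (h : G.IsRealizedOn (Sum.inl : V → V ⊕ Fin k) Set.univ (Set.range Sum.inr)) :
    G.IsCompetitionGraphAfterAdding k := by
  obtain ⟨A, r, hA, hAG⟩ := h
  refine ⟨⟨A⟩, fun v hv => ?_, ?_⟩
  · have hdec : ∀ a b, Relation.TransGen A a b → r b < r a := by
      intro a b hab
      induction hab with
      | single h => exact (hA _ _ h).2.2
      | tail _ h ih => exact ((hA _ _ h).2.2).trans ih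
    exact (hdec v v hv).false
  · have hinr : ∀ i u, ¬ A (Sum.inr i) u := by
      intro i u h
      obtain ⟨x, -, hx⟩ := (hA _ _ h).1
      cases hx
    ext a b
    simp only [Digraph.competitionGraph]
    rcases a with x | i <;> rcases b with y | j
    · by_cases hxy : x = y
      · simp [hxy]
      · simpa [hxy] using (hAG x trivial y trivial hxy).symm
    all_goals simp [hinr]

/-- One isolated vertex more than the number of holes is enough. -/
theorem competitionNumber_le_holeNumber_add_one [Finite V] (G : SimpleGraph V)
    (hG : ∀ C C' : G.Subgraph, C.IsHole → C'.IsHole → C ≠ C' → Disjoint C.edgeSet C'.edgeSet) :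
    G.competitionNumber ≤ G.holeNumber + 1 := by
  refine Nat.sInf_le (IsRealizedOn.isCompetitionGraphAfterAdding
    (isRealizedOn_of_holeNumberOn_lt Sum.inl_injective hG _ _ ?_ ?_))
  · rw [Set.disjoint_left]
    rintro _ ⟨x, -, rfl⟩ ⟨i, hi⟩
    cases hi
  · rw [holeNumberOn_univ, ← Set.image_univ, Set.ncard_image_of_injective _ Sum.inr_injective,
      Set.ncard_univ, Nat.card_fin]
    exact Nat.lt_succ_self _

/-! ### The hole space -/

theorem Subgraph.IsHole.edgeSet_nonempty {C : G.Subgraph} (hC : C.IsHole) :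
    C.edgeSet.Nonempty := by
  obtain ⟨-, n, hn, ⟨e⟩⟩ := hC
  have h01 : (cycleGraph n).Adj ⟨0, by omega⟩ ⟨1, by omega⟩ :=
    (cycleGraph_adj_iff_of_lt (by simp)).2 (Or.inl rfl)
  exact ⟨s(_, _), Subgraph.mem_edgeSet.2 (e.symm.map_adj_iff.2 h01)⟩

/-- Edge vectors of edge-disjoint holes are linearly independent because their supports are
nonempty and pairwise disjoint. -/
theorem linearIndependent_edgeVector
    (hG : ∀ C C' : G.Subgraph, C.IsHole → C'.IsHole → C ≠ C' → Disjoint C.edgeSet C'.edgeSet) :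
    LinearIndependent (ZMod 2) (fun C : {C : G.Subgraph // C.IsHole} => C.1.edgeVector) := by
  rw [linearIndependent_iff']
  intro s g hsum C hC
  obtain ⟨e, he⟩ := C.2.edgeSet_nonempty
  have hval := congrFun hsum ⟨e, C.1.edgeSet_subset he⟩
  rw [Finset.sum_apply, Finset.sum_eq_single C] at hval
  · simpa [Subgraph.edgeVector, he] using hval
  · intro C' _ hne
    have he' : e ∉ C'.1.edgeSet := fun h =>
      Set.disjoint_left.1 (hG C'.1 C.1 C'.2 C.2 (Subtype.coe_ne_coe.2 hne)) h he
    simp [Subgraph.edgeVector, he']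
  · exact fun h => absurd hC h

theorem finrank_holeSpace [Finite V]
    (h : LinearIndependent (ZMod 2) (fun C : {C : G.Subgraph // C.IsHole} => C.1.edgeVector)) :
    Module.finrank (ZMod 2) G.holeSpace = G.holeNumber := by
  have := Fintype.ofFinite {C : G.Subgraph // C.IsHole}
  have hspan : G.holeSpace = Submodule.span (ZMod 2)
      (Set.range fun C : {C : G.Subgraph // C.IsHole} => C.1.edgeVector) := by
    rw [holeSpace]
    congr 1
    ext χ
    simp
  rw [hspan, finrank_span_eq_card h, ← Nat.card_eq_fintype_card, holeNumber]
  rfl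

end SimpleGraph

theorem mainTheorem7 {V : Type*} [Finite V] (G : SimpleGraph V)
    (hG : ∀ C C' : G.Subgraph, C.IsHole → C'.IsHole → C ≠ C' →
      Disjoint C.edgeSet C'.edgeSet) :
    LinearIndependent (ZMod 2) (fun C : {C : G.Subgraph // C.IsHole} => C.1.edgeVector) ∧
      Module.finrank (ZMod 2) G.holeSpace = G.holeNumber ∧
      G.competitionNumber ≤ Module.finrank (ZMod 2) G.holeSpace + 1 := by
  have hli := SimpleGraph.linearIndependent_edgeVector hG
  have hrank := SimpleGraph.finrank_holeSpace hli
  exact ⟨hli, hrank, hrank ▸ G.competitionNumber_le_holeNumber_add_one hG⟩
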